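/- Let $n\ge 1$, let $U\subset\mathbb R^n$ be a connected open set that meets the line $x(\tau)=(0,\dots,0,\tau)$, and let $f=(f_1,\dots,f_n):U\to\mathbb R^n$ be a real analytic solution of the system $$\frac{\partial f_i}{\partial x^j}=f_i\,\frac{\partial f_1}{\partial x^{j+1}}+\frac{\partial f_{i+1}}{\partial x^{j+1}},\qquad \frac{\partial f_n}{\partial x^j}=f_n\,\frac{\partial f_1}{\partial x^{j+1}}\qquad(1\le i,j\le n-1).$$ For $c=(c_1,\dots,c_n)\in\mathbb R^n$ put $\chi_c(t)=t^n-c_1t^{n-1}-\dots-c_{n-1}t-c_n$. (1) If the discriminant of $\chi_{f(x(\tau))}$ vanishes for all $\tau$ with $x(\tau)\in U$, then the discriminant of $\chi_{f(x)}$ vanishes for all $x\in U$. (2) Let $n=k_1+\dots+k_s$ with positive integers $k_1,\dots,k_s$. Let $W_{k_1,\dots,k_s}\subset\mathbb R^n$ be the set of those $c$ for which $\chi_c$ has exactly $s$ distinct complex roots, with multiplicities $k_1,\dots,k_s$, and let $\overline W_{k_1,\dots,k_s}\subset\mathbb R^n$ be its Zariski closure, that is, the set of common real zeros of all real polynomials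 in $n$ variables that vanish on $W_{k_1,\dots,k_s}$. If $f(x(\tau))\in\overline W_{k_1,\dots,k_s}$ for all $\tau$ with $x(\tau)\in U$, then $f(x)\in\overline W_{k_1,\dots,k_s}$ for all $x\in U$. -/

import Mathlib

open Polynomial

namespace NijenhuisCompanion

/-- The partial derivative `∂g/∂xʲ` at `x` of a real function of `n` real variables. -/
noncomputable def pd {n : ℕ} (j : Fin n) (g : (Fin n → ℝ) → ℝ) (x : Fin n → ℝ) : ℝ :=
  fderiv ℝ g x (Pi.single j 1)

/-- The quasilinear system, on the set `U`, for `f = (f₁, …, fₙ)` with `n = m + 1`: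
`∂fᵢ/∂xʲ = fᵢ ∂f₁/∂xʲ⁺¹ + ∂fᵢ₊₁/∂xʲ⁺¹` and `∂fₙ/∂xʲ = fₙ ∂f₁/∂xʲ⁺¹` for `1 ≤ i, j ≤ n - 1`.
Indices are shifted by one: `f₁` is the component `0` and `fₙ` is the component `Fin.last m`. -/
def SolvesSystem {m : ℕ} (U : Set (Fin (m + 1) → ℝ))
    (f : (Fin (m + 1) → ℝ) → (Fin (m + 1) → ℝ)) : Prop :=
  ∀ x ∈ U, ∀ j : Fin m,
    (∀ i : Fin m,
      pd j.castSucc (fun y => f y i.castSucc) x =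
        f x i.castSucc * pd j.succ (fun y => f y 0) x +
          pd j.succ (fun y => f y i.succ) x) ∧
    pd j.castSucc (fun y => f y (Fin.last m)) x =
      f x (Fin.last m) * pd j.succ (fun y => f y 0) x

/-- The initial line `x(τ) = (0, …, 0, τ)`. -/
def initialLine (m : ℕ) (τ : ℝ) : Fin (m + 1) → ℝ :=
  Pi.single (Fin.last m) τ

/-- The polynomial `χ_c(t) = tⁿ - c₁ tⁿ⁻¹ - ⋯ - cₙ₋₁ t - cₙ`, where `n = m + 1`. -/
noncomputable def charPoly {m : ℕ} (c : Fin (m + 1) → ℝ) : ℝ[X] :=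
  X ^ (m + 1) - ∑ i : Fin (m + 1), C (c i) * X ^ (m - (i : ℕ))

/-- The layer `W_{k₁, …, k_s}`: the points `c ∈ ℝⁿ` such that `χ_c` has exactly `s` distinct
complex roots, and these have multiplicities `k₁, …, k_s`. -/
def layer {m s : ℕ} (k : Fin s → ℕ) : Set (Fin (m + 1) → ℝ) :=
  {c | ∃ μ : Fin s → ℂ, Function.Injective μ ∧
    (charPoly c).rootSet ℂ = Set.range μ ∧
    ∀ i, ((charPoly c).map (algebraMap ℝ ℂ)).rootMultiplicity (μ i) = k i}

/-- The Zariski closure of a subset of real affine space: the common real zeros of all real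
polynomials that vanish on the subset. -/
def zariskiClosure {n : ℕ} (S : Set (Fin n → ℝ)) : Set (Fin n → ℝ) :=
  MvPolynomial.zeroLocus ℝ (MvPolynomial.vanishingIdeal ℝ S)

end NijenhuisCompanion

/-! Write `χ` for the polynomial with coefficients `f`. The system says exactly that `∂_j χ = t
∂_{j+1} χ + (∂_{j+1} f₁) χ`. Hence, modulo `χ`, every directional derivative `∂_v χ` is `p ∂_n χ`
for some polynomial `p` in `t` (`exists_polyDer_eq`). Formally a root `λ` then obeys `∂_v λ = p(λ)
∂_n λ`. This equation determines `λ` from its values on the initial line, so roots that coincide on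
the line stay equal.

Roots need not be analytic, so the argument is made formal. Taylor expansion along the line at a
point `x₀` maps analytic functions to `ℝ⟦X⟧`, inside an algebraically closed field `K` to which
`d/dX` extends as a derivation `D`. Expanding in direction `v` gives `χ` over `K⟦X⟧` with `χ' = p Dχ
+ qχ`. For each root `a ∈ K` of the initial polynomial one solves `Λ' = p(Λ) DΛ`, `Λ(0) = a`; then
`χ = ∏ (t - Λ(a))` over the multiset of initial roots (`eq_prod_of_evolution`). Since `Λ` is a
function of `a`, multiplicities persist. A relation `g` forced by them has zero Taylor series in
every direction at `x₀`, hence vanishes on `U` (`relation_of_relations_on_line`).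

It remains to turn each condition on the line into multiplicities over `K`. A vanishing discriminant
gives a repeated root. For the closure of a layer, the map from roots to coefficients is integral,
so by lying over every `K`-point of the closure comes from roots with multiplicities `k`
(`exists_roots_of_zero_vanishingIdeal`), possibly with coincidences. -/

namespace NijenhuisCompanion

open scoped PowerSeries

/-! ### Formal evolution equations and the propagation of roots -/

section FormalPowerSeries

variable {R : Type*} [CommRing R]

/-- A derivation acting on the coefficients of a polynomial. -/
noncomputable def polyDer {A : Type*} [CommRing A] [Algebra R A] (d : Derivation R A A) :
    Derivation R A[X] A[X] :=
  PolynomialModule.equivPolynomialSelf.compDer d.mapCoeffs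

@[simp]
lemma coeff_polyDer {A : Type*} [CommRing A] [Algebra R A] (d : Derivation R A A) (p : A[X])
    (i : ℕ) : (polyDer d p).coeff i = d (p.coeff i) := rfl

@[simp]
lemma polyDer_C {A : Type*} [CommRing A] [Algebra R A] (d : Derivation R A A) (a : A) :
    polyDer d (C a) = C (d a) := by
  ext i
  rw [coeff_polyDer, coeff_C, coeff_C]
  split_ifs <;> simp

@[simp]
lemma polyDer_X {A : Type*} [CommRing A] [Algebra R A] (d : Derivation R A A) :
    polyDer d (X : A[X]) = 0 := by
  ext i
  rw [coeff_polyDer, coeff_X]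
  split_ifs <;> simp

lemma map_polyDer {A B : Type*} [CommRing A] [Algebra R A] [CommRing B] [Algebra R B]
    (d : Derivation R A A) (e : Derivation R B B) (φ : A →+* B) (h : ∀ a, φ (d a) = e (φ a))
    (p : A[X]) : (polyDer d p).map φ = polyDer e (p.map φ) := by
  ext i
  simp [h]

/-- The chain rule for the evaluation of a polynomial with varying coefficients. -/
lemma derivation_eval {A : Type*} [CommRing A] [Algebra R A] (d : Derivation R A A) (p : A[X])
    (x : A) : d (p.eval x) = (polyDer d p).eval x + p.derivative.eval x * d x := by
  induction p using Polynomial.induction_on with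
  | C a => simp
  | add p q hp hq => simp only [eval_add, map_add, hp, hq]; ring
  | monomial n a h =>
    have e : (C a * X ^ (n + 1) : A[X]) = (C a * X ^ n) * X := by ring
    rw [e]
    generalize (C a * X ^ n : A[X]) = q at h
    rw [eval_mul, Derivation.leibniz, h, Derivation.leibniz, derivative_mul]
    simp only [eval_X, smul_eq_mul, eval_add, eval_mul, polyDer_X, derivative_X, eval_one,
      eval_zero]
    ring

/-- A derivation acting on the coefficients of a power series. -/
noncomputable def seriesDer {A : Type*} [CommRing A] [Algebra R A] (d : Derivation R A A) :
    Derivation R A⟦X⟧ A⟦X⟧ :=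
  Derivation.mk'
    { toFun := fun f => PowerSeries.mk fun n => d (PowerSeries.coeff n f)
      map_add' := fun f g => by ext n; simp
      map_smul' := fun r f => by
        ext n
        simp only [PowerSeries.coeff_mk, RingHom.id_apply]
        rw [PowerSeries.coeff_smul, PowerSeries.coeff_smul, d.map_smul, PowerSeries.coeff_mk] }
    fun f g => by
      ext n
      simp only [LinearMap.coe_mk, AddHom.coe_mk, PowerSeries.coeff_mk, smul_eq_mul, map_add,
        PowerSeries.coeff_mul, map_sum, Derivation.leibniz, Finset.sum_add_distrib]
      congr 1
      rw [← Finset.Nat.sum_antidiagonal_swap]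
      rfl

@[simp]
lemma coeff_seriesDer {A : Type*} [CommRing A] [Algebra R A] (d : Derivation R A A) (f : A⟦X⟧)
    (n : ℕ) : PowerSeries.coeff n (seriesDer d f) = d (PowerSeries.coeff n f) :=
  PowerSeries.coeff_mk n fun n => d (PowerSeries.coeff n f)

lemma X_pow_dvd_seriesDer {A : Type*} [CommRing A] [Algebra R A] (d : Derivation R A A)
    {f : A⟦X⟧} {n : ℕ} (h : (PowerSeries.X : A⟦X⟧) ^ n ∣ f) :
    (PowerSeries.X : A⟦X⟧) ^ n ∣ seriesDer d f := by
  refine PowerSeries.X_pow_dvd_iff.2 fun m hm => ?_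
  rw [coeff_seriesDer, PowerSeries.X_pow_dvd_iff.1 h m hm, map_zero]

/-- The derivative of power series as a derivation over a base of the coefficient ring. -/
noncomputable def ddX (R A : Type*) [CommRing R] [CommRing A] [Algebra R A] :
    Derivation R A⟦X⟧ A⟦X⟧ :=
  (PowerSeries.derivative A).restrictScalars R

@[simp]
lemma coeff_ddX {A : Type*} [CommRing A] [Algebra R A] (f : A⟦X⟧) (n : ℕ) :
    PowerSeries.coeff n (ddX R A f) = PowerSeries.coeff (n + 1) f * (n + 1) :=
  PowerSeries.coeff_derivative f n

variable {K : Type*} [Field K] [CharZero K] [Algebra R K]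

/-- In characteristic zero, integration gains one order of vanishing. This drives both the
uniqueness and the existence arguments. -/
lemma X_pow_succ_dvd_of_ddX {f : K⟦X⟧} {n : ℕ} (h0 : PowerSeries.constantCoeff f = 0)
    (h : PowerSeries.X ^ n ∣ ddX R K f) : PowerSeries.X ^ (n + 1) ∣ f := by
  rw [PowerSeries.X_pow_dvd_iff] at h ⊢
  rintro (_ | m) hm
  · simpa using h0
  · have := h m (by omega)
    rw [coeff_ddX] at this
    exact (mul_eq_zero.1 this).resolve_right (Nat.cast_add_one_ne_zero m)

lemma eq_zero_of_forall_X_pow_dvd {A : Type*} [CommRing A] {f : A⟦X⟧}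
    (h : ∀ n, (PowerSeries.X : A⟦X⟧) ^ n ∣ f) : f = 0 := by
  ext n
  exact (PowerSeries.X_pow_dvd_iff.1 (h (n + 1))) n n.lt_succ_self

/-- Uniqueness for a linear homogeneous evolution equation with zero initial value. -/
lemma eq_zero_of_linear_evolution (D : Derivation R K K) {E P Q : K⟦X⟧}
    (h0 : PowerSeries.constantCoeff E = 0)
    (h : ddX R K E = P * seriesDer D E + Q * E) : E = 0 := by
  refine eq_zero_of_forall_X_pow_dvd fun n => ?_
  induction n with
  | zero => simp
  | succ n ih =>
    -- `D` acts on coefficients, so the right-hand side vanishes to the same order as `E`;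
    -- integrating raises that order by one.
    refine X_pow_succ_dvd_of_ddX (R := R) h0 ?_
    rw [h]
    exact dvd_add ((X_pow_dvd_seriesDer D ih).mul_left _) (ih.mul_left _)

/-- An evolution equation whose right-hand side does not lower the order of contact has a solution
for each initial value. -/
lemma exists_evolution (R : Type*) [CommRing R] [Algebra R K] (Φ : K⟦X⟧ → K⟦X⟧)
    (hΦ : ∀ f g n, PowerSeries.X ^ n ∣ f - g → PowerSeries.X ^ n ∣ Φ f - Φ g) (a : K) :
    ∃ y : K⟦X⟧, PowerSeries.constantCoeff y = a ∧ ddX R K y = Φ y := by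
  -- Picard iteration: `J` integrates with constant term `a`, and the iterates of `J ∘ Φ` converge
  -- `X`-adically.
  let J : K⟦X⟧ → K⟦X⟧ := fun f =>
    PowerSeries.mk fun n => Nat.casesOn n a fun k => PowerSeries.coeff k f / (k + 1)
  have hJ0 : ∀ f, PowerSeries.constantCoeff (J f) = a := fun f => by
    rw [← PowerSeries.coeff_zero_eq_constantCoeff_apply]
    exact PowerSeries.coeff_mk _ _
  have hJ : ∀ f, ddX R K (J f) = f := fun f => by
    ext n
    rw [coeff_ddX, PowerSeries.coeff_mk]
    exact div_mul_cancel₀ _ (Nat.cast_add_one_ne_zero n)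
  let Y : ℕ → K⟦X⟧ := fun n => Nat.rec (PowerSeries.C a) (fun _ y => J (Φ y)) n
  have hY0 : ∀ n, PowerSeries.constantCoeff (Y n) = a := by
    rintro (_ | n)
    · exact PowerSeries.constantCoeff_C a
    · exact hJ0 _
  have hstep : ∀ n, PowerSeries.X ^ (n + 1) ∣ Y (n + 1) - Y n := by
    intro n
    induction n with
    | zero =>
      rw [zero_add, pow_one, PowerSeries.X_dvd_iff, map_sub, hY0, hY0, sub_self]
    | succ n ih =>
      refine X_pow_succ_dvd_of_ddX (R := R)
        (by rw [map_sub, hY0 (n + 1), hY0 (n + 1 + 1), sub_self]) ?_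
      rw [map_sub]
      change _ ∣ ddX R K (J (Φ (Y (n + 1)))) - ddX R K (J (Φ (Y n)))
      rw [hJ, hJ]
      exact hΦ _ _ _ ih
  -- The coefficient of index `n` is stable from the iterate `Y n` on, so the limit is read off the
  -- diagonal.
  let y : K⟦X⟧ := PowerSeries.mk fun n => PowerSeries.coeff n (Y n)
  have hcoeff : ∀ n k, PowerSeries.coeff n (Y (n + k)) = PowerSeries.coeff n (Y n) := by
    intro n k
    induction k with
    | zero => rfl
    | succ k ih =>
      rw [← ih, ← sub_eq_zero, ← map_sub]
      exact PowerSeries.X_pow_dvd_iff.1 (hstep (n + k)) n (by omega)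
  have hy : ∀ n, PowerSeries.X ^ (n + 1) ∣ y - Y n := by
    intro n
    rw [PowerSeries.X_pow_dvd_iff]
    intro m hm
    obtain ⟨k, rfl⟩ := Nat.exists_eq_add_of_le (Nat.lt_succ_iff.1 hm)
    rw [map_sub, hcoeff, PowerSeries.coeff_mk, sub_self]
  refine ⟨y, ?_, ?_⟩
  · rw [← PowerSeries.coeff_zero_eq_constantCoeff_apply, PowerSeries.coeff_mk]
    simpa using hY0 0
  · rw [← sub_eq_zero]
    refine eq_zero_of_forall_X_pow_dvd fun n => ?_
    have h1 : PowerSeries.X ^ n ∣ ddX R K (y - Y (n + 1)) := by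
      rw [PowerSeries.X_pow_dvd_iff]
      intro m hm
      rw [coeff_ddX, PowerSeries.X_pow_dvd_iff.1 (hy (n + 1)) (m + 1) (by omega), zero_mul]
    have h2 := hΦ _ _ _ ((pow_dvd_pow PowerSeries.X n.le_succ).trans (hy n))
    rw [map_sub] at h1
    have h3 : ddX R K (Y (n + 1)) = Φ (Y n) := hJ _
    rw [h3] at h1
    have := dvd_sub h1 h2
    rwa [sub_sub_sub_cancel_right] at this

/-- Solutions of the equation `Λ' = p(Λ) D Λ` with arbitrary initial value. -/
lemma exists_burgers (D : Derivation R K K) (p : K⟦X⟧[X]) (a : K) :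
    ∃ y : K⟦X⟧, PowerSeries.constantCoeff y = a ∧
      ddX R K y = p.eval y * seriesDer D y := by
  refine exists_evolution R (fun y => p.eval y * seriesDer D y) (fun f g n h => ?_) a
  have e : p.eval f * seriesDer D f - p.eval g * seriesDer D g =
      p.eval f * seriesDer D (f - g) + (p.eval f - p.eval g) * seriesDer D g := by
    rw [map_sub]; ring
  rw [e]
  exact dvd_add ((X_pow_dvd_seriesDer D h).mul_left _)
    ((h.trans (sub_dvd_eval_sub f g p)).mul_right _)

/-- If a monic polynomial over power series evolves by `χ' ≡ p D χ` modulo `χ`, then its roots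
evolve by `Λ' = p(Λ) D Λ`, with constant multiplicities. -/
lemma eq_prod_of_evolution (D : Derivation R K K) (p : K⟦X⟧[X]) (Λ : K → K⟦X⟧)
    (hΛ0 : ∀ a, PowerSeries.constantCoeff (Λ a) = a)
    (hΛ : ∀ a, ddX R K (Λ a) = p.eval (Λ a) * seriesDer D (Λ a)) (M : Multiset K) :
    ∀ χ : K⟦X⟧[X], χ.Monic → (∃ q, polyDer (ddX R K) χ = p * polyDer (seriesDer D) χ + q * χ) →
      χ.map PowerSeries.constantCoeff = (M.map fun a => X - C a).prod →
      χ = (M.map fun a => X - C (Λ a)).prod := by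
  induction M using Multiset.induction_on with
  | empty =>
    intro χ hm _ h
    simp only [Multiset.map_zero, Multiset.prod_zero] at h ⊢
    refine hm.natDegree_eq_zero.1 ?_
    rw [← hm.natDegree_map PowerSeries.constantCoeff, h, natDegree_one]
  | cons a M ih =>
    rintro χ hm ⟨q, hq⟩ h
    -- By the chain rule and the equation for `Λ a`, the value `χ(Λ a)` satisfies a linear
    -- homogeneous evolution equation with zero initial value.
    have hroot : χ.eval (Λ a) = 0 := by
      refine eq_zero_of_linear_evolution D (P := p.eval (Λ a)) (Q := q.eval (Λ a)) ?_ ?_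
      · rw [← eval₂_at_apply, hΛ0, ← eval_map, h]
        simp
      · rw [derivation_eval, derivation_eval, hq, hΛ]
        simp only [eval_add, eval_mul]
        ring
    obtain ⟨ψ, rfl⟩ := dvd_iff_isRoot.2 hroot
    have hψ : ψ.Monic := (monic_X_sub_C _).of_mul_monic_left hm
    have hX : (X - C (Λ a) : K⟦X⟧[X]) ≠ 0 := X_sub_C_ne_zero _
    -- The cofactor `ψ` evolves by the same `p`: the terms from differentiating `X - Λ a` combine to
    -- `(p - p(Λ a)) DΛ ψ`, which is divisible by `X - Λ a` and only changes `q`.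
    obtain ⟨r, hr⟩ : (X - C (Λ a)) ∣ p - C (p.eval (Λ a)) := by
      rw [dvd_iff_isRoot]; simp
    rw [Multiset.map_cons, Multiset.prod_cons, ← ih ψ hψ ⟨q - r * C (seriesDer D (Λ a)), ?_⟩ ?_]
    · refine mul_left_cancel₀ hX ?_
      rw [Derivation.leibniz, Derivation.leibniz] at hq
      simp only [smul_eq_mul, map_sub, polyDer_X, polyDer_C, hΛ, map_mul] at hq
      linear_combination hq - C (seriesDer D (Λ a)) * ψ * hr
    · rw [Polynomial.map_mul, Multiset.map_cons, Multiset.prod_cons] at h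
      refine mul_left_cancel₀ (X_sub_C_ne_zero a) ?_
      rw [← h]
      simp [hΛ0]

end FormalPowerSeries

/-! ### Taylor expansion along a derivation -/

section Taylor

variable {k R A : Type*} [Field k] [CommRing R] [Algebra k R] [CommRing A]
  [Algebra k A]

/-- The Taylor series along a derivation `d` of the values under a homomorphism `ρ`. -/
noncomputable def taylorFun (d : Derivation k R R) (ρ : R →ₐ[k] A) (r : R) : A⟦X⟧ :=
  PowerSeries.mk fun n => (n.factorial : k)⁻¹ • ρ (d^[n] r)

lemma coeff_taylorFun (d : Derivation k R R) (ρ : R →ₐ[k] A) (r : R) (n : ℕ) :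
    PowerSeries.coeff n (taylorFun d ρ r) = (n.factorial : k)⁻¹ • ρ (d^[n] r) :=
  PowerSeries.coeff_mk _ _

lemma ddX_taylorFun [CharZero k] (d : Derivation k R R) (ρ : R →ₐ[k] A) (r : R) :
    ddX k A (taylorFun d ρ r) = taylorFun d ρ (d r) := by
  ext n
  rw [coeff_ddX, coeff_taylorFun, coeff_taylorFun, Function.iterate_succ_apply]
  have : ((n : A) + 1) = algebraMap k A (n + 1) := by simp
  rw [this, mul_comm, ← Algebra.smul_def, smul_smul]
  congr 1
  have h1 : (n.factorial : k) ≠ 0 := by exact_mod_cast n.factorial_ne_zero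
  have h2 : (n + 1 : k) ≠ 0 := by exact_mod_cast n.succ_ne_zero
  rw [Nat.factorial_succ]
  push_cast
  field_simp

lemma taylorFun_add (d : Derivation k R R) (ρ : R →ₐ[k] A) (a b : R) :
    taylorFun d ρ (a + b) = taylorFun d ρ a + taylorFun d ρ b := by
  ext n
  simp only [map_add, coeff_taylorFun]
  rw [iterate_map_add, map_add, smul_add]

lemma taylorFun_mul [CharZero k] (d : Derivation k R R) (ρ : R →ₐ[k] A) (a b : R) :
    taylorFun d ρ (a * b) = taylorFun d ρ a * taylorFun d ρ b := by
  ext n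
  induction n generalizing a b with
  | zero =>
    rw [PowerSeries.coeff_mul]
    simp [coeff_taylorFun]
  | succ n ih =>
    -- Compare derivatives, where the induction hypothesis applies to both Leibniz terms, then
    -- cancel the unit `n + 1`.
    have key : PowerSeries.coeff n (ddX k A (taylorFun d ρ (a * b))) =
        PowerSeries.coeff n (ddX k A (taylorFun d ρ a * taylorFun d ρ b)) := by
      rw [ddX_taylorFun, Derivation.leibniz, Derivation.leibniz, ddX_taylorFun, ddX_taylorFun,
        taylorFun_add, map_add, map_add]
      simp only [smul_eq_mul, ih]
    rw [coeff_ddX, coeff_ddX] at key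
    have hu : IsUnit ((n : A) + 1) := by
      have : ((n : A) + 1) = algebraMap k A (n + 1) := by simp
      rw [this]
      exact (IsUnit.mk0 _ (by exact_mod_cast n.succ_ne_zero)).map _
    exact hu.mul_left_injective key

lemma taylorFun_algebraMap (d : Derivation k R R) (ρ : R →ₐ[k] A) (c : k) :
    taylorFun d ρ (algebraMap k R c) = algebraMap k A⟦X⟧ c := by
  ext n
  rw [coeff_taylorFun, PowerSeries.algebraMap_apply, PowerSeries.coeff_C]
  rcases n with _ | n
  · simp
  · rw [Function.iterate_succ_apply, d.map_algebraMap, iterate_map_zero]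
    simp

/-- The Taylor series along a derivation, as a homomorphism. -/
noncomputable def taylorHom [CharZero k] (d : Derivation k R R) (ρ : R →ₐ[k] A) :
    R →ₐ[k] A⟦X⟧ where
  toFun := taylorFun d ρ
  map_zero' := by simpa using taylorFun_algebraMap d ρ 0
  map_one' := by simpa using taylorFun_algebraMap d ρ 1
  map_add' := taylorFun_add d ρ
  map_mul' := taylorFun_mul d ρ
  commutes' := taylorFun_algebraMap d ρ

lemma coeff_taylorHom [CharZero k] (d : Derivation k R R) (ρ : R →ₐ[k] A) (r : R) (n : ℕ) :
    PowerSeries.coeff n (taylorHom d ρ r) = (n.factorial : k)⁻¹ • ρ (d^[n] r) :=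
  coeff_taylorFun d ρ r n

lemma constantCoeff_taylorHom [CharZero k] (d : Derivation k R R) (ρ : R →ₐ[k] A) (r : R) :
    PowerSeries.constantCoeff (taylorHom d ρ r) = ρ r := by
  simp [← PowerSeries.coeff_zero_eq_constantCoeff_apply, coeff_taylorHom]

lemma ddX_taylorHom [CharZero k] (d : Derivation k R R) (ρ : R →ₐ[k] A) (r : R) :
    ddX k A (taylorHom d ρ r) = taylorHom d ρ (d r) :=
  ddX_taylorFun d ρ r

/-- Commuting derivations are needed so that `δ` can be moved past the iterates of `d` and become
`D` on each coefficient. -/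
lemma seriesDer_taylorHom [CharZero k] (d δ : Derivation k R R) (ρ : R →ₐ[k] A)
    (D : Derivation k A A)
    (hc : ∀ r, d (δ r) = δ (d r)) (hD : ∀ r, ρ (δ r) = D (ρ r)) (r : R) :
    seriesDer D (taylorHom d ρ r) = taylorHom d ρ (δ r) := by
  ext n
  have hcomm : Function.Commute d δ := hc
  rw [coeff_seriesDer, coeff_taylorHom, coeff_taylorHom, D.map_smul, ← hD,
    (hcomm.iterate_left n).eq]

lemma taylorHom_eq_zero_iff [CharZero k] (d : Derivation k R R) (ρ : R →ₐ[k] A) (r : R) :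
    taylorHom d ρ r = 0 ↔ ∀ n, ρ (d^[n] r) = 0 := by
  refine ⟨fun h n => ?_, fun h => ?_⟩
  · have := coeff_taylorHom d ρ r n
    rw [h, map_zero, eq_comm, smul_eq_zero_iff_right] at this
    · exact this
    · exact inv_ne_zero (by exact_mod_cast n.factorial_ne_zero)
  · ext n
    rw [coeff_taylorHom, h, smul_zero, map_zero]

end Taylor

/-! ### Extending derivations to an algebraic closure -/

section ExtensionOfDerivations

/-- For formally étale `B` over `A`, the differentials of `B` are the base change of those of `A`,
so a derivation of `A` induces one of `B`. -/
lemma exists_derivation_of_formallyEtale (k A B : Type) [CommRing k] [CommRing A] [CommRing B]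
    [Algebra k A] [Algebra k B] [Algebra A B] [IsScalarTower k A B] [Algebra.FormallyEtale A B]
    (d : Derivation k A A) :
    ∃ D : Derivation k B B, ∀ a, D (algebraMap A B a) = algebraMap A B (d a) := by
  let e := KaehlerDifferential.tensorKaehlerEquivOfFormallyEtale k A B
  let l : TensorProduct A B (Ω[A⁄k]) →ₗ[B] B :=
    LinearMap.liftBaseChange B (Algebra.linearMap A B ∘ₗ d.liftKaehlerDifferential)
  refine ⟨(l ∘ₗ e.symm.toLinearMap).compDer (KaehlerDifferential.D k B), fun a => ?_⟩
  have h := KaehlerDifferential.tensorKaehlerEquivOfFormallyEtale_symm_D_algebraMap k A B a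
  change l (e.symm (KaehlerDifferential.D k B (algebraMap A B a))) = _
  rw [h]
  simp [l]

/-- Localizations are formally étale, and so are algebraic extensions in characteristic zero, being
separable. -/
lemma exists_derivation_algebraicClosure (k A : Type) [Field k] [CharZero k] [CommRing A]
    [IsDomain A] [Algebra k A] (d : Derivation k A A) :
    ∃ D : Derivation k (AlgebraicClosure (FractionRing A)) (AlgebraicClosure (FractionRing A)),
      ∀ a, D (algebraMap A _ a) = algebraMap A _ (d a) := by
  have : CharZero (FractionRing A) := charZero_of_injective_algebraMap
    (algebraMap k (FractionRing A)).injective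
  have h1 : Algebra.FormallyEtale A (FractionRing A) :=
    Algebra.FormallyEtale.of_isLocalization (nonZeroDivisors A)
  have h2 : Algebra.FormallyEtale (FractionRing A) (AlgebraicClosure (FractionRing A)) :=
    Algebra.FormallyEtale.of_isSeparable _ _
  have h3 : Algebra.FormallyEtale A (AlgebraicClosure (FractionRing A)) :=
    Algebra.FormallyEtale.comp A (FractionRing A) _
  exact exists_derivation_of_formallyEtale k A _ d

end ExtensionOfDerivations

/-! ### The differential algebra of real analytic functions -/

section AnalyticFunctions

variable {n : ℕ} {U : Set (Fin n → ℝ)}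

/-- The algebra of real analytic functions on a set. -/
def analyticFun (U : Set (Fin n → ℝ)) : Subalgebra ℝ (U → ℝ) where
  carrier := {g | ∃ G : (Fin n → ℝ) → ℝ, AnalyticOnNhd ℝ G U ∧ ∀ x : U, G x = g x}
  mul_mem' := by
    rintro _ _ ⟨G, hG, h⟩ ⟨G', hG', h'⟩
    exact ⟨G * G', hG.mul hG', fun x => by simp [h, h']⟩
  add_mem' := by
    rintro _ _ ⟨G, hG, h⟩ ⟨G', hG', h'⟩
    exact ⟨G + G', hG.add hG', fun x => by simp [h, h']⟩
  algebraMap_mem' r := ⟨fun _ => r, analyticOnNhd_const, fun x => rfl⟩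

/-- The restriction of an analytic function. -/
def restrictAnalytic (G : (Fin n → ℝ) → ℝ) (hG : AnalyticOnNhd ℝ G U) : analyticFun U :=
  ⟨fun x => G x, G, hG, fun _ => rfl⟩

@[simp]
lemma restrictAnalytic_apply (G : (Fin n → ℝ) → ℝ) (hG : AnalyticOnNhd ℝ G U) (x : U) :
    (restrictAnalytic G hG).1 x = G x := rfl

lemma exists_eq_restrictAnalytic (g : analyticFun U) :
    ∃ G, ∃ hG : AnalyticOnNhd ℝ G U, g = restrictAnalytic G hG := by
  obtain ⟨g, G, hG, h⟩ := g
  exact ⟨G, hG, Subtype.ext (funext fun x => (h x).symm)⟩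

/-- An analytic extension of an analytic function on `U` to the whole space. -/
noncomputable def extendAnalytic (g : analyticFun U) : (Fin n → ℝ) → ℝ := g.2.choose

lemma analyticOnNhd_extendAnalytic (g : analyticFun U) : AnalyticOnNhd ℝ (extendAnalytic g) U :=
  g.2.choose_spec.1

@[simp]
lemma extendAnalytic_apply (g : analyticFun U) (x : U) : extendAnalytic g x = g.1 x :=
  g.2.choose_spec.2 x

lemma extendAnalytic_eqOn (G : (Fin n → ℝ) → ℝ) (hG : AnalyticOnNhd ℝ G U) :
    Set.EqOn (extendAnalytic (restrictAnalytic G hG)) G U :=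
  fun x hx => extendAnalytic_apply (restrictAnalytic G hG) ⟨x, hx⟩

lemma analyticOnNhd_fderiv_apply {G : (Fin n → ℝ) → ℝ} (hG : AnalyticOnNhd ℝ G U)
    (v : Fin n → ℝ) : AnalyticOnNhd ℝ (fun x => fderiv ℝ G x v) U :=
  (ContinuousLinearMap.apply ℝ ℝ v).comp_analyticOnNhd hG.fderiv

/-- The directional derivative, as a function on the algebra of analytic functions. -/
noncomputable def dirDerFun (v : Fin n → ℝ) (g : analyticFun U) : analyticFun U :=
  restrictAnalytic (fun x => fderiv ℝ (extendAnalytic g) x v)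
    (analyticOnNhd_fderiv_apply (analyticOnNhd_extendAnalytic g) v)

lemma dirDerFun_mk (hU : IsOpen U) (v : Fin n → ℝ) (G : (Fin n → ℝ) → ℝ)
    (hG : AnalyticOnNhd ℝ G U) :
    dirDerFun v (restrictAnalytic G hG) =
      restrictAnalytic (fun x => fderiv ℝ G x v) (analyticOnNhd_fderiv_apply hG v) := by
  refine Subtype.ext (funext fun x => ?_)
  have : extendAnalytic (restrictAnalytic G hG) =ᶠ[nhds (x : Fin n → ℝ)] G :=
    (extendAnalytic_eqOn G hG).eventuallyEq_of_mem (hU.mem_nhds x.2)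
  simp [dirDerFun, this.fderiv_eq]

/-- The directional derivative, as a derivation of the algebra of analytic functions. -/
noncomputable def dirDer (hU : IsOpen U) (v : Fin n → ℝ) :
    Derivation ℝ (analyticFun U) (analyticFun U) :=
  Derivation.mk'
    { toFun := dirDerFun v
      map_add' := fun g h => by
        obtain ⟨G, hG, rfl⟩ := exists_eq_restrictAnalytic g
        obtain ⟨H, hH, rfl⟩ := exists_eq_restrictAnalytic h
        rw [show restrictAnalytic G hG + restrictAnalytic H hH =
          restrictAnalytic (G + H) (hG.add hH) from rfl,
          dirDerFun_mk hU, dirDerFun_mk hU, dirDerFun_mk hU]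
        refine Subtype.ext (funext fun x => ?_)
        have h1 := (hG x x.2).differentiableAt
        have h2 := (hH x x.2).differentiableAt
        simp [fderiv_add h1 h2]
      map_smul' := fun r g => by
        obtain ⟨G, hG, rfl⟩ := exists_eq_restrictAnalytic g
        rw [show r • restrictAnalytic G hG = restrictAnalytic (r • G) (hG.const_smul) from rfl,
          dirDerFun_mk hU, dirDerFun_mk hU]
        refine Subtype.ext (funext fun x => ?_)
        have h1 := (hG x x.2).differentiableAt
        simp [fderiv_const_smul h1] }
    fun g h => by
      obtain ⟨G, hG, rfl⟩ := exists_eq_restrictAnalytic g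
      obtain ⟨H, hH, rfl⟩ := exists_eq_restrictAnalytic h
      simp only [LinearMap.coe_mk, AddHom.coe_mk]
      rw [show restrictAnalytic G hG * restrictAnalytic H hH =
        restrictAnalytic (G * H) (hG.mul hH) from rfl,
          dirDerFun_mk hU, dirDerFun_mk hU, dirDerFun_mk hU]
      refine Subtype.ext (funext fun x => ?_)
      have h1 := (hG x x.2).differentiableAt
      have h2 := (hH x x.2).differentiableAt
      simp [fderiv_mul h1 h2]

lemma dirDer_mk (hU : IsOpen U) (v : Fin n → ℝ) (G : (Fin n → ℝ) → ℝ)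
    (hG : AnalyticOnNhd ℝ G U) :
    dirDer hU v (restrictAnalytic G hG) =
      restrictAnalytic (fun x => fderiv ℝ G x v) (analyticOnNhd_fderiv_apply hG v) :=
  dirDerFun_mk hU v G hG

lemma dirDer_add (hU : IsOpen U) (v w : Fin n → ℝ) :
    dirDer hU (v + w) = dirDer hU v + dirDer hU w := by
  ext g
  obtain ⟨G, hG, rfl⟩ := exists_eq_restrictAnalytic g
  simp only [Derivation.add_apply, dirDer_mk]
  simp

lemma dirDer_smul (hU : IsOpen U) (r : ℝ) (v : Fin n → ℝ) :
    dirDer hU (r • v) = r • dirDer hU v := by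
  ext g
  obtain ⟨G, hG, rfl⟩ := exists_eq_restrictAnalytic g
  simp only [Derivation.smul_apply, dirDer_mk]
  simp

lemma dirDer_comm (hU : IsOpen U) (v w : Fin n → ℝ) (g : analyticFun U) :
    dirDer hU v (dirDer hU w g) = dirDer hU w (dirDer hU v g) := by
  obtain ⟨G, hG, rfl⟩ := exists_eq_restrictAnalytic g
  simp only [dirDer_mk]
  refine Subtype.ext (funext fun x => ?_)
  have hs : IsSymmSndFDerivAt ℝ G x :=
    ((hG x x.2).contDiffAt (n := 2)).isSymmSndFDerivAt (by simp)
  have hd : DifferentiableAt ℝ (fderiv ℝ G) x := (hG.fderiv x x.2).differentiableAt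
  simp only [restrictAnalytic_apply]
  rw [fderiv_clm_apply hd (differentiableAt_const _),
    fderiv_clm_apply hd (differentiableAt_const _)]
  simpa using hs v w

/-- Evaluation of analytic functions at a point. -/
def evalAt (x : U) : analyticFun U →ₐ[ℝ] ℝ :=
  (Pi.evalAlgHom ℝ (fun _ : U => ℝ) x).comp (analyticFun U).val

@[simp]
lemma evalAt_apply (x : U) (g : analyticFun U) : evalAt x g = g.1 x := rfl

lemma hasDerivAt_along_line (hU : IsOpen U) (g : analyticFun U) (x v : Fin n → ℝ) (s : ℝ)
    (hs : x + s • v ∈ U) :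
    HasDerivAt (fun s : ℝ => extendAnalytic g (x + s • v))
      (extendAnalytic (dirDer hU v g) (x + s • v)) s := by
  have h1 : HasFDerivAt (extendAnalytic g) (fderiv ℝ (extendAnalytic g) (x + s • v)) (x + s • v) :=
    (analyticOnNhd_extendAnalytic g _ hs).differentiableAt.hasFDerivAt
  have h2 : HasDerivAt (fun s : ℝ => x + s • v) v s := by
    simpa using ((hasDerivAt_id s).smul_const v).const_add x
  have h3 := h1.comp_hasDerivAt s h2
  have h4 : extendAnalytic (dirDer hU v g) (x + s • v) =
      fderiv ℝ (extendAnalytic g) (x + s • v) v :=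
    extendAnalytic_apply (dirDer hU v g) ⟨_, hs⟩
  rw [h4]
  exact h3

/-- Vanishing along a line is inherited by the derivatives in its direction. -/
lemma iterate_dirDer_eq_zero_of_line (hU : IsOpen U) (g : analyticFun U) (x v : Fin n → ℝ)
    (h : ∀ s : ℝ, ∀ hs : x + s • v ∈ U, g.1 ⟨x + s • v, hs⟩ = 0) (k : ℕ) :
    ∀ s : ℝ, ∀ hs : x + s • v ∈ U, ((dirDer hU v)^[k] g).1 ⟨x + s • v, hs⟩ = 0 := by
  induction k with
  | zero => exact h
  | succ k ih =>
    intro s hs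
    rw [Function.iterate_succ_apply', ← extendAnalytic_apply]
    have h1 := hasDerivAt_along_line hU ((dirDer hU v)^[k] g) x v s hs
    have hc : Continuous fun s : ℝ => x + s • v := by fun_prop
    have h2 : (fun s : ℝ => extendAnalytic ((dirDer hU v)^[k] g) (x + s • v)) =ᶠ[nhds s]
        fun _ => 0 := by
      filter_upwards [hc.continuousAt.preimage_mem_nhds (hU.mem_nhds hs)] with t ht
      rw [← ih t ht, ← extendAnalytic_apply]
    exact h1.unique ((hasDerivAt_const s (0 : ℝ)).congr_of_eventuallyEq h2)

/-- An analytic function whose derivatives along all directions vanish at a point of a connected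
open set vanishes on the set. -/
lemma analyticFun_eq_zero (hU : IsOpen U) (hUc : IsPreconnected U) (g : analyticFun U) (x₀ : U)
    (h : ∀ (v : Fin n → ℝ) (k : ℕ), ((dirDer hU v)^[k] g).1 x₀ = 0) (x : U) : g.1 x = 0 := by
  obtain ⟨ε, hε, hB⟩ := Metric.isOpen_iff.1 hU x₀ x₀.2
  have hev : extendAnalytic g =ᶠ[nhds (x₀ : Fin n → ℝ)] 0 := by
    filter_upwards [Metric.ball_mem_nhds (x₀ : Fin n → ℝ) hε] with y hy
    obtain ⟨v, rfl⟩ : ∃ v, y = x₀ + v := ⟨y - x₀, by simp⟩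
    -- Near `x₀` the claim reduces to one variable: on the segment from `x₀` to `y` inside the ball,
    -- `φ` has all derivatives zero at `0`.
    let S : Set ℝ := {s | (x₀ : Fin n → ℝ) + s • v ∈ Metric.ball (x₀ : Fin n → ℝ) ε}
    have hSU : ∀ s ∈ S, (x₀ : Fin n → ℝ) + s • v ∈ U := fun s hs => hB hs
    have hc : Continuous fun s : ℝ => (x₀ : Fin n → ℝ) + s • v := by fun_prop
    have hSo : IsOpen S := Metric.isOpen_ball.preimage hc
    have hSc : Convex ℝ S := by
      intro s hs t ht a b ha hb hab
      have := convex_ball (x₀ : Fin n → ℝ) ε hs ht ha hb hab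
      have e : a • ((x₀ : Fin n → ℝ) + s • v) + b • ((x₀ : Fin n → ℝ) + t • v) =
          (x₀ : Fin n → ℝ) + (a • s + b • t) • v := by
        ext i
        simp only [Pi.add_apply, Pi.smul_apply, smul_eq_mul]
        linear_combination (x₀ : Fin n → ℝ) i * hab
      rwa [e] at this
    have h0 : (0 : ℝ) ∈ S := by simpa [S] using hε
    have h1 : (1 : ℝ) ∈ S := by simpa [S] using hy
    let φ : ℝ → ℝ := fun s => extendAnalytic g (x₀ + s • v)
    have hφ : AnalyticOnNhd ℝ φ S := by
      intro s hs
      have ha : AnalyticAt ℝ (fun s : ℝ => (x₀ : Fin n → ℝ) + s • v) s := by fun_prop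
      exact AnalyticAt.comp (g := extendAnalytic g) (f := fun s : ℝ => (x₀ : Fin n → ℝ) + s • v)
        (analyticOnNhd_extendAnalytic g _ (hSU s hs)) ha
    have hder : ∀ k : ℕ, ∀ s ∈ S,
        iteratedDeriv k φ s = extendAnalytic ((dirDer hU v)^[k] g) (x₀ + s • v) := by
      intro k
      induction k with
      | zero => intro s hs; simp [φ]
      | succ k ih =>
        intro s hs
        rw [iteratedDeriv_succ, Function.iterate_succ_apply',
          Filter.EventuallyEq.deriv_eq (Filter.eventuallyEq_of_mem (hSo.mem_nhds hs) ih)]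
        exact (hasDerivAt_along_line hU _ _ v s (hSU s hs)).deriv
    have hzero : ∀ k : ℕ, iteratedDeriv k φ 0 = 0 := by
      intro k
      rw [hder k 0 h0, zero_smul, add_zero, extendAnalytic_apply, h v k]
    have hφ0 : φ =ᶠ[nhds 0] 0 := by
      have : analyticOrderAt φ 0 = ⊤ := by
        rw [ENat.eq_top_iff_forall_ge]
        intro k
        exact (natCast_le_analyticOrderAt_iff_iteratedDeriv_eq_zero (hφ 0 h0)).2
          fun i _ => hzero i
      exact analyticOrderAt_eq_top.1 this
    have := hφ.eqOn_zero_of_preconnected_of_eventuallyEq_zero hSc.isPreconnected h0 hφ0 h1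
    simpa [φ] using this
  have := (analyticOnNhd_extendAnalytic g).eqOn_zero_of_preconnected_of_eventuallyEq_zero
    hUc x₀.2 hev x.2
  rwa [extendAnalytic_apply] at this

end AnalyticFunctions

/-! ### Monic polynomials and their coefficient vectors -/

section UniversalPolynomial

variable {m : ℕ} {R S : Type*} [CommRing R] [CommRing S]

/-- The polynomial `tⁿ - c₁ tⁿ⁻¹ - ⋯ - cₙ`, `n = m + 1`, over a commutative ring. -/
noncomputable def companionPoly (c : Fin (m + 1) → R) : R[X] :=
  X ^ (m + 1) - ∑ i : Fin (m + 1), C (c i) * X ^ (m - (i : ℕ))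

lemma charPoly_eq (c : Fin (m + 1) → ℝ) : charPoly c = companionPoly c := rfl

lemma map_companionPoly (φ : R →+* S) (c : Fin (m + 1) → R) :
    (companionPoly c).map φ = companionPoly fun i => φ (c i) := by
  simp [companionPoly, Polynomial.map_sum]

lemma degree_companionPoly_sum_lt (c : Fin (m + 1) → R) :
    (∑ i : Fin (m + 1), C (c i) * X ^ (m - (i : ℕ))).degree < ((m + 1 : ℕ) : WithBot ℕ) := by
  rw [← Polynomial.mem_degreeLT]
  refine Submodule.sum_mem _ fun i _ => ?_
  rw [Polynomial.mem_degreeLT]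
  refine (degree_C_mul_X_pow_le _ _).trans_lt ?_
  exact_mod_cast (by omega : m - (i : ℕ) < m + 1)

lemma monic_companionPoly (c : Fin (m + 1) → R) : (companionPoly c).Monic :=
  monic_X_pow_sub (degree_companionPoly_sum_lt c)

lemma natDegree_companionPoly [Nontrivial R] (c : Fin (m + 1) → R) :
    (companionPoly c).natDegree = m + 1 := by
  have h : (companionPoly c).degree = ((m + 1 : ℕ) : WithBot ℕ) := by
    rw [companionPoly, degree_sub_eq_left_of_degree_lt, degree_X_pow]
    rw [degree_X_pow]
    exact degree_companionPoly_sum_lt c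
  exact natDegree_eq_of_degree_eq_some h

lemma coeff_companionPoly (c : Fin (m + 1) → R) (i : Fin (m + 1)) :
    (companionPoly c).coeff (m - (i : ℕ)) = -c i := by
  rw [companionPoly, coeff_sub, coeff_X_pow, if_neg (by omega), finsetSum_coeff,
    Finset.sum_eq_single i]
  · simp
  · intro j _ hj
    rw [coeff_C_mul, coeff_X_pow, if_neg, mul_zero]
    intro h
    exact hj (Fin.ext (by omega))
  · simp

lemma companionPoly_injective {c c' : Fin (m + 1) → R} (h : companionPoly c = companionPoly c') :
    c = c' := by
  funext i
  have := coeff_companionPoly c i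
  rw [h, coeff_companionPoly] at this
  exact (neg_injective this).symm

lemma companionPoly_coeff {q : R[X]} (hq : q.Monic) (hd : q.natDegree = m + 1) :
    companionPoly (fun i : Fin (m + 1) => -q.coeff (m - (i : ℕ))) = q := by
  conv_rhs => rw [hq.as_sum, hd]
  rw [companionPoly, sub_eq_add_neg, ← Finset.sum_neg_distrib, ← Fin.sum_univ_eq_sum_range
    (fun i => C (q.coeff i) * X ^ i) (m + 1), ← Equiv.sum_comp Fin.revPerm]
  congr 1
  refine Finset.sum_congr rfl fun i _ => ?_
  have : m - (i : ℕ) = (Fin.revPerm i : ℕ) := by simp [Fin.val_rev]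
  have h2 : m - (Fin.revPerm i : ℕ) = i := by simp [Fin.val_rev]; omega
  rw [h2]
  simp

end UniversalPolynomial

/-! ### Layers parametrized by roots -/

section Layers

variable {m s : ℕ} (k : Fin s → ℕ)

/-- The monic polynomial with roots `μ i` of multiplicities `k i`. -/
noncomputable def rootsPoly {R : Type*} [CommRing R] (μ : Fin s → R) : R[X] :=
  ∏ i, (X - C (μ i)) ^ k i

lemma map_rootsPoly {R S : Type*} [CommRing R] [CommRing S] (φ : R →+* S) (μ : Fin s → R) :
    (rootsPoly k μ).map φ = rootsPoly k fun i => φ (μ i) := by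
  simp [rootsPoly, Polynomial.map_prod]

lemma monic_rootsPoly {R : Type*} [CommRing R] (μ : Fin s → R) : (rootsPoly k μ).Monic :=
  monic_prod_of_monic _ _ fun _ _ => (monic_X_sub_C _).pow _

lemma natDegree_rootsPoly {R : Type*} [CommRing R] [Nontrivial R] (μ : Fin s → R) :
    (rootsPoly k μ).natDegree = ∑ i, k i := by
  rw [rootsPoly, natDegree_prod_of_monic _ _ fun _ _ => (monic_X_sub_C _).pow _]
  refine Finset.sum_congr rfl fun i _ => ?_
  rw [(monic_X_sub_C _).natDegree_pow, natDegree_X_sub_C, mul_one]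

lemma rootMultiplicity_rootsPoly {R : Type*} [CommRing R] [IsDomain R] {μ : Fin s → R}
    (hμ : Function.Injective μ) (i : Fin s) : (rootsPoly k μ).rootMultiplicity (μ i) = k i := by
  classical
  rw [← count_roots, rootsPoly, roots_prod _ _ (monic_rootsPoly k μ).ne_zero]
  simp only [roots_pow, roots_X_sub_C, Multiset.count_bind, Multiset.count_nsmul]
  change ∑ j, k j * Multiset.count (μ i) {μ j} = k i
  rw [Finset.sum_eq_single i]
  · simp
  · intro j _ hj
    rw [Multiset.count_singleton, if_neg fun h => hj (hμ h).symm, mul_zero]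
  · simp

/-- The coordinates `c` of the polynomial with roots of given multiplicities, as polynomials in the
roots. -/
noncomputable def layerCoord (m : ℕ) {s : ℕ} (k : Fin s → ℕ) (i : Fin (m + 1)) :
    MvPolynomial (Fin s) ℝ :=
  -(rootsPoly k (MvPolynomial.X : Fin s → MvPolynomial (Fin s) ℝ)).coeff (m - (i : ℕ))

variable {k}

lemma companionPoly_layerCoord (hk : ∑ i, k i = m + 1) :
    companionPoly (layerCoord m k) = rootsPoly k (MvPolynomial.X (R := ℝ)) :=
  companionPoly_coeff (monic_rootsPoly k _) (by rw [natDegree_rootsPoly, hk])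

lemma companionPoly_aeval_layerCoord (hk : ∑ i, k i = m + 1) {B : Type*} [CommRing B]
    [Algebra ℝ B] (μ : Fin s → B) :
    companionPoly (fun i => MvPolynomial.aeval μ (layerCoord m k i)) = rootsPoly k μ := by
  have := map_companionPoly (MvPolynomial.aeval μ : MvPolynomial (Fin s) ℝ →ₐ[ℝ] B).toRingHom
    (layerCoord m k)
  rw [companionPoly_layerCoord hk, map_rootsPoly] at this
  simpa using this.symm

lemma aeval_eq_aeval_bind₁_layerCoord (hk : ∑ i, k i = m + 1) {B : Type*} [CommRing B]
    [Algebra ℝ B] {μ : Fin s → B} {c : Fin (m + 1) → B} (h : companionPoly c = rootsPoly k μ)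
    (g : MvPolynomial (Fin (m + 1)) ℝ) :
    MvPolynomial.aeval c g =
      MvPolynomial.aeval μ (MvPolynomial.bind₁ (layerCoord m k) g) := by
  rw [← companionPoly_aeval_layerCoord hk] at h
  rw [MvPolynomial.aeval_bind₁, companionPoly_injective h]

lemma mem_layer_of_companionPoly_eq (hpos : ∀ i, 0 < k i) {c : Fin (m + 1) → ℝ} {μ : Fin s → ℝ}
    (hμ : Function.Injective μ) (h : companionPoly c = rootsPoly k μ) : c ∈ layer k := by
  have hμ' : Function.Injective fun i => (μ i : ℂ) := Complex.ofReal_injective.comp hμ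
  have hmap : (charPoly c).map (algebraMap ℝ ℂ) = rootsPoly k fun i => (μ i : ℂ) := by
    rw [charPoly_eq, h, map_rootsPoly]; rfl
  refine ⟨fun i => (μ i : ℂ), hμ', ?_, fun i => ?_⟩
  · have hne : charPoly c ≠ 0 := (monic_companionPoly c).ne_zero
    ext z
    rw [mem_rootSet_of_ne hne, aeval_def, ← eval_map, hmap, rootsPoly, eval_prod,
      Finset.prod_eq_zero_iff]
    simp only [Finset.mem_univ, true_and, eval_pow, eval_sub, eval_X, eval_C, Set.mem_range]
    refine exists_congr fun i => ?_
    rw [pow_eq_zero_iff (hpos i).ne', sub_eq_zero, eq_comm]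
  · rw [hmap]
    exact rootMultiplicity_rootsPoly k hμ' i

lemma map_charPoly_of_mem_layer {c : Fin (m + 1) → ℝ} (h : c ∈ layer k) :
    ∃ μ : Fin s → ℂ, (charPoly c).map (algebraMap ℝ ℂ) = rootsPoly k μ := by
  classical
  obtain ⟨μ, hμ, hroots, hmult⟩ := h
  refine ⟨μ, ?_⟩
  set q := (charPoly c).map (algebraMap ℝ ℂ) with hq
  have hm : q.Monic := (monic_companionPoly c).map _
  have h1 : q = (q.roots.map fun a => X - C a).prod :=
    (IsAlgClosed.splits q).eq_prod_roots_of_monic hm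
  have h2 : q.roots.toFinset = Finset.univ.image μ := by
    ext z
    have : z ∈ (charPoly c).rootSet ℂ ↔ z ∈ q.roots.toFinset := by
      rw [rootSet, aroots, Finset.mem_coe]
    rw [← this, hroots]
    simp
  rw [h1, prod_multiset_root_eq_finset_root, h2, Finset.prod_image fun i _ j _ h => hμ h, rootsPoly]
  refine Finset.prod_congr rfl fun i _ => ?_
  rw [hmult i]

/-- Distinct real roots give points of the layer, so the pullback of `g` vanishes off the diagonals.
Multiplied by the product `δ` of root differences it vanishes on all of `ℝˢ`, hence is zero. -/
lemma bind₁_layerCoord_eq_zero (hpos : ∀ i, 0 < k i) (hk : ∑ i, k i = m + 1)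
    {g : MvPolynomial (Fin (m + 1)) ℝ}
    (hg : g ∈ MvPolynomial.vanishingIdeal ℝ (layer (m := m) k)) :
    MvPolynomial.bind₁ (layerCoord m k) g = 0 := by
  classical
  let δ : MvPolynomial (Fin s) ℝ :=
    ∏ p ∈ (Finset.univ : Finset (Fin s)).offDiag, (MvPolynomial.X p.1 - MvPolynomial.X p.2)
  have hδ : δ ≠ 0 := by
    refine Finset.prod_ne_zero_iff.2 fun p hp => sub_ne_zero.2 fun h => ?_
    exact (Finset.mem_offDiag.1 hp).2.2 (MvPolynomial.X_injective h)
  have : MvPolynomial.bind₁ (layerCoord m k) g * δ = 0 := by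
    refine MvPolynomial.funext fun μ => ?_
    rw [map_mul, map_zero]
    by_cases hμ : Function.Injective μ
    · have h0 := hg _ (mem_layer_of_companionPoly_eq hpos hμ (companionPoly_aeval_layerCoord hk μ))
      rw [aeval_eq_aeval_bind₁_layerCoord hk (companionPoly_aeval_layerCoord hk μ)] at h0
      rw [← MvPolynomial.coe_aeval_eq_eval, RingHom.coe_coe, h0, zero_mul]
    · rw [Function.Injective] at hμ
      push Not at hμ
      obtain ⟨i, j, hij, hne⟩ := hμ
      have : MvPolynomial.eval μ δ = 0 := by
        rw [map_prod]
        refine Finset.prod_eq_zero (i := (i, j)) (by simpa using hne) ?_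
        simp [hij]
      rw [this, mul_zero]
  exact (mul_eq_zero.1 this).resolve_right hδ

/-- Points of the layer may have non-real roots, so the parametrization is used over `ℂ`. With
`bind₁_layerCoord_eq_zero`, the vanishing ideal is the kernel of the pullback. -/
lemma mem_vanishingIdeal_of_bind₁_layerCoord (hk : ∑ i, k i = m + 1)
    {g : MvPolynomial (Fin (m + 1)) ℝ} (hg : MvPolynomial.bind₁ (layerCoord m k) g = 0) :
    g ∈ MvPolynomial.vanishingIdeal ℝ (layer (m := m) k) := by
  intro c hc
  obtain ⟨μ, hμ⟩ := map_charPoly_of_mem_layer hc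
  rw [charPoly_eq, map_companionPoly] at hμ
  have := aeval_eq_aeval_bind₁_layerCoord hk hμ g
  rw [hg, map_zero] at this
  refine (algebraMap ℝ ℂ).injective (Eq.trans ?_ (this.trans (map_zero _).symm))
  exact (MvPolynomial.aeval_algebraMap_apply ℂ c g).symm

/-- Each root variable is a zero of the monic polynomial whose coefficients are the `layerCoord`;
positivity of its multiplicity is what makes it a zero. -/
lemma isIntegral_bind₁_layerCoord (hpos : ∀ i, 0 < k i) (hk : ∑ i, k i = m + 1) :
    (MvPolynomial.bind₁ (layerCoord m k)).toRingHom.IsIntegral := by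
  intro p
  induction p using MvPolynomial.induction_on with
  | C a =>
    have : MvPolynomial.C a = (MvPolynomial.bind₁ (layerCoord m k)).toRingHom
        (MvPolynomial.C a) := by simp
    rw [this]
    exact RingHom.isIntegralElem_map _
  | add p q hp hq => exact hp.add _ hq
  | mul_X p i hp =>
    refine hp.mul _ ⟨companionPoly MvPolynomial.X, monic_companionPoly _, ?_⟩
    rw [← eval_map, map_companionPoly]
    have : companionPoly (fun i => (MvPolynomial.bind₁ (layerCoord m k)).toRingHom
        (MvPolynomial.X i)) = rootsPoly k (MvPolynomial.X (R := ℝ)) := by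
      rw [← companionPoly_layerCoord hk]
      congr 1
      funext i
      simp
    rw [this, rootsPoly, eval_prod]
    refine Finset.prod_eq_zero (Finset.mem_univ i) ?_
    simp [(hpos i).ne']

end Layers

/-! ### Lifting points along integral homomorphisms -/

section IntegralLift

/-- A homomorphism into an algebraically closed field lifts along an integral homomorphism whose
kernel it annihilates. -/
lemma exists_lift_of_isIntegral {A B K : Type*} [CommRing A] [CommRing B] [Field K]
    [IsAlgClosed K] (φ : A →+* B) (hφ : φ.IsIntegral) (ψ : A →+* K)
    (h : RingHom.ker φ ≤ RingHom.ker ψ) : ∃ ψ' : B →+* K, ψ'.comp φ = ψ := by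
  let _ : Algebra A B := φ.toAlgebra
  have : Algebra.IsIntegral A B := ⟨hφ⟩
  have hP : (RingHom.ker ψ).IsPrime := RingHom.ker_isPrime ψ
  -- Lying over gives a prime `Q` above `ker ψ`; the domain `B ⧸ Q` is then integral over `A ⧸ ker
  -- ψ` and maps to the algebraically closed `K`.
  obtain ⟨Q, -, hQ, hQP⟩ := Ideal.exists_ideal_over_prime_of_isIntegral (RingHom.ker ψ)
    (⊥ : Ideal B) h
  have hQo : Q.LiesOver (RingHom.ker ψ) := ⟨hQP.symm⟩
  let _ : Algebra (A ⧸ RingHom.ker ψ) K := (RingHom.kerLift ψ).toAlgebra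
  have hinj : Function.Injective (algebraMap (A ⧸ RingHom.ker ψ) K) := RingHom.kerLift_injective ψ
  have hT1 : Module.IsTorsionFree (A ⧸ RingHom.ker ψ) K :=
    Module.isTorsionFree_iff_algebraMap_injective.2 hinj
  have hfs : FaithfulSMul (A ⧸ RingHom.ker ψ) (B ⧸ Q) :=
    Ideal.Quotient.instFaithfulSMul Q _
  have hT2 : Module.IsTorsionFree (A ⧸ RingHom.ker ψ) (B ⧸ Q) :=
    Module.isTorsionFree_iff_algebraMap_injective.2 (FaithfulSMul.algebraMap_injective _ _)
  have hint : Algebra.IsIntegral (A ⧸ RingHom.ker ψ) (B ⧸ Q) := inferInstance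
  let l : (B ⧸ Q) →ₐ[A ⧸ RingHom.ker ψ] K := IsAlgClosed.lift
  refine ⟨l.toRingHom.comp (Ideal.Quotient.mk Q), RingHom.ext fun a => ?_⟩
  exact l.commutes (Ideal.Quotient.mk _ a)

/-- A point over an algebraically closed field at which all polynomials vanishing on the layer
vanish comes from roots of the given multiplicities. -/
lemma exists_roots_of_zero_vanishingIdeal {m s : ℕ} {k : Fin s → ℕ} (hpos : ∀ i, 0 < k i)
    (hk : ∑ i, k i = m + 1) {K : Type*} [Field K] [IsAlgClosed K] [Algebra ℝ K]
    (c : Fin (m + 1) → K)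
    (hc : ∀ g ∈ MvPolynomial.vanishingIdeal ℝ (layer (m := m) k), MvPolynomial.aeval c g = 0) :
    ∃ μ : Fin s → K, companionPoly c = rootsPoly k μ := by
  obtain ⟨ψ, hψ⟩ := exists_lift_of_isIntegral _ (isIntegral_bind₁_layerCoord hpos hk)
    (MvPolynomial.aeval c : MvPolynomial (Fin (m + 1)) ℝ →ₐ[ℝ] K).toRingHom
    fun g hg => hc g (mem_vanishingIdeal_of_bind₁_layerCoord hk hg)
  refine ⟨fun i => ψ (MvPolynomial.X i), ?_⟩
  rw [← map_rootsPoly, ← companionPoly_layerCoord hk, map_companionPoly]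
  congr 1
  funext i
  have := RingHom.congr_fun hψ (MvPolynomial.X i)
  simpa using this.symm

end IntegralLift

/-! ### The discriminant and repeated roots -/

section Discriminant

variable {m : ℕ}

/-- The resultant of `χ_c` and its derivative, as a polynomial in `c`. -/
noncomputable def resultantPoly (m : ℕ) : MvPolynomial (Fin (m + 1)) ℝ :=
  resultant (companionPoly (MvPolynomial.X (R := ℝ)))
    (companionPoly (MvPolynomial.X (R := ℝ))).derivative (m + 1) m

/-- Fixing the formal degrees `m + 1` and `m` lets the resultant commute with every ring
homomorphism. -/
lemma aeval_resultantPoly {B : Type*} [CommRing B] [Algebra ℝ B] (c : Fin (m + 1) → B) :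
    MvPolynomial.aeval c (resultantPoly m) =
      resultant (companionPoly c) (companionPoly c).derivative (m + 1) m := by
  have h : (companionPoly (MvPolynomial.X (R := ℝ))).map
      (MvPolynomial.aeval c : MvPolynomial (Fin (m + 1)) ℝ →ₐ[ℝ] B).toRingHom =
        companionPoly c := by
    rw [map_companionPoly]; simp
  rw [← h, derivative_map, resultant_map_map]
  rfl

lemma discr_charPoly_eq_zero_iff (c : Fin (m + 1) → ℝ) :
    (charPoly c).discr = 0 ↔ MvPolynomial.aeval c (resultantPoly m) = 0 := by
  have hd := natDegree_companionPoly c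
  have := resultant_deriv (f := companionPoly c) (natDegree_pos_iff_degree_pos.1 (by omega))
  rw [(monic_companionPoly c).leadingCoeff, hd, Nat.add_sub_cancel] at this
  rw [aeval_resultantPoly, this, charPoly_eq]
  simp

lemma natDegree_derivative_companionPoly_le {B : Type*} [CommRing B] [Nontrivial B]
    (c : Fin (m + 1) → B) : (companionPoly c).derivative.natDegree ≤ m := by
  refine (natDegree_derivative_le _).trans ?_
  rw [natDegree_companionPoly]
  omega

lemma not_nodup_roots_of_aeval_resultantPoly {K : Type*} [Field K] [IsAlgClosed K] [Algebra ℝ K]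
    (c : Fin (m + 1) → K) (h : MvPolynomial.aeval c (resultantPoly m) = 0) :
    ¬ (companionPoly c).roots.Nodup := by
  intro hn
  rw [nodup_roots_iff_of_splits (monic_companionPoly c).ne_zero (IsAlgClosed.splits _),
    separable_def] at hn
  rw [aeval_resultantPoly] at h
  have : CharZero K := charZero_of_injective_algebraMap (algebraMap ℝ K).injective
  -- Characteristic zero makes the formal degree `m` the true degree of the derivative, so
  -- coprimality gives a nonzero resultant.
  have hd : (companionPoly c).derivative.natDegree = m := by
    rw [natDegree_derivative, natDegree_companionPoly, Nat.add_sub_cancel]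
  refine resultant_ne_zero _ _ hn ?_
  rwa [hd, natDegree_companionPoly]

/-- The resultant is a combination of the polynomial and its derivative, both zero at a double root.
No field is needed, so this applies over `K⟦X⟧`. -/
lemma aeval_resultantPoly_eq_zero {B : Type*} [CommRing B] [Nontrivial B] [Algebra ℝ B]
    (c : Fin (m + 1) → B) {b : B} {q : B[X]} (h : companionPoly c = (X - C b) ^ 2 * q) :
    MvPolynomial.aeval c (resultantPoly m) = 0 := by
  obtain ⟨p, q', -, -, he⟩ := exists_mul_add_mul_eq_C_resultant (companionPoly c)
    (companionPoly c).derivative (m := m + 1) (n := m) (natDegree_companionPoly c).le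
    (natDegree_derivative_companionPoly_le c) (Or.inl (by omega))
  rw [aeval_resultantPoly]
  have := congrArg (eval b) he
  rw [eval_C] at this
  rw [← this]
  simp [h, derivative_mul, derivative_pow]

end Discriminant

/-! ### The system as an evolution of the characteristic polynomial -/

section Companion

variable {m : ℕ} {R A : Type*} [CommRing R] [CommRing A] [Algebra R A]

lemma polyDer_companionPoly (d : Derivation R A A) (c : Fin (m + 1) → A) :
    polyDer d (companionPoly c) = -∑ i : Fin (m + 1), C (d (c i)) * X ^ (m - (i : ℕ)) := by
  have hX : ∀ k : ℕ, polyDer d (X ^ k : A[X]) = 0 := fun k => by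
    rw [Derivation.leibniz_pow, polyDer_X, smul_zero, smul_zero]
  rw [companionPoly, map_sub, hX, zero_sub, map_sum]
  congr 1
  refine Finset.sum_congr rfl fun i _ => ?_
  rw [Derivation.leibniz, hX, smul_zero, zero_add, polyDer_C, smul_eq_mul, mul_comm]

/-- The quasilinear system in terms of the characteristic polynomial. -/
lemma polyDer_companionPoly_step (d e : Derivation R A A) (c : Fin (m + 1) → A)
    (h1 : ∀ i : Fin m, d (c i.castSucc) = c i.castSucc * e (c 0) + e (c i.succ))
    (h2 : d (c (Fin.last m)) = c (Fin.last m) * e (c 0)) :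
    polyDer d (companionPoly c) =
      X * polyDer e (companionPoly c) + C (e (c 0)) * companionPoly c := by
  have h3 : X * (∑ i : Fin (m + 1), C (e (c i)) * X ^ (m - (i : ℕ))) =
      C (e (c 0)) * X ^ (m + 1) + ∑ i : Fin m, C (e (c i.succ)) * X ^ (m - (i : ℕ)) := by
    rw [Fin.sum_univ_succ, mul_add, Finset.mul_sum]
    congr 1
    · simp only [Fin.val_zero, Nat.sub_zero]; ring
    · refine Finset.sum_congr rfl fun i _ => ?_
      have : m - (i : ℕ) = (m - (i.succ : ℕ)) + 1 := by
        have := i.2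
        simp only [Fin.val_succ]
        omega
      rw [this]
      ring
  have h4 : ∑ i : Fin (m + 1), C (d (c i)) * X ^ (m - (i : ℕ)) =
      C (e (c 0)) * (∑ i : Fin (m + 1), C (c i) * X ^ (m - (i : ℕ))) +
        ∑ i : Fin m, C (e (c i.succ)) * X ^ (m - (i : ℕ)) := by
    rw [Fin.sum_univ_castSucc, Fin.sum_univ_castSucc, mul_add, Finset.mul_sum, h2,
      add_right_comm, ← Finset.sum_add_distrib]
    congr 1
    · refine Finset.sum_congr rfl fun i _ => ?_
      rw [h1, C_add, C_mul, Fin.val_castSucc]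
      ring
    · rw [C_mul]; ring
  rw [polyDer_companionPoly, polyDer_companionPoly, mul_neg, h3, h4, companionPoly]
  ring

/-- Descending from the last index, each step multiplies `p` by `X` and corrects `q`; a general
direction follows by linearity. -/
lemma exists_polyDer_companionPoly (e : Fin (m + 1) → Derivation R A A) (c : Fin (m + 1) → A)
    (h1 : ∀ j i : Fin m,
      e j.castSucc (c i.castSucc) = c i.castSucc * e j.succ (c 0) + e j.succ (c i.succ))
    (h2 : ∀ j : Fin m, e j.castSucc (c (Fin.last m)) = c (Fin.last m) * e j.succ (c 0))
    (d : Derivation R A A) (v : Fin (m + 1) → R) (hd : ∀ a, d a = ∑ j, v j • e j a) :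
    ∃ p q : A[X], polyDer d (companionPoly c) =
      p * polyDer (e (Fin.last m)) (companionPoly c) + q * companionPoly c := by
  have hbasis : ∀ j : Fin (m + 1), ∃ p q : A[X], polyDer (e j) (companionPoly c) =
      p * polyDer (e (Fin.last m)) (companionPoly c) + q * companionPoly c := by
    intro j
    induction j using Fin.reverseInduction with
    | last => exact ⟨1, 0, by ring⟩
    | cast j ih =>
      obtain ⟨p, q, h⟩ := ih
      rw [polyDer_companionPoly_step _ _ _ (h1 j) (h2 j), h]
      exact ⟨X * p, X * q + C (e j.succ (c 0)), by ring⟩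
  choose p q h using hbasis
  have hpd : polyDer d (companionPoly c) = ∑ j, v j • polyDer (e j) (companionPoly c) := by
    ext1 i
    rw [coeff_polyDer, hd, finsetSum_coeff]
    simp
  refine ⟨∑ j, v j • p j, ∑ j, v j • q j, ?_⟩
  rw [hpd, Finset.sum_mul, Finset.sum_mul, ← Finset.sum_add_distrib]
  refine Finset.sum_congr rfl fun j _ => ?_
  rw [h, smul_add, smul_mul_assoc, smul_mul_assoc]

end Companion

lemma prod_map_sum_nsmul {ι K B : Type*} [Fintype ι] [CommMonoid B] (k : ι → ℕ) (μ : ι → K)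
    (F : K → B) :
    ((∑ i, k i • ({μ i} : Multiset K)).map F).prod = ∏ i, F (μ i) ^ k i := by
  have h : (∑ i, k i • ({μ i} : Multiset K)).map F = ∑ i, k i • ({F (μ i)} : Multiset B) := by
    rw [← Multiset.coe_mapAddMonoidHom, map_sum]
    simp [Multiset.map_nsmul]
  rw [h, Multiset.prod_sum]
  simp [Multiset.prod_nsmul]

/-! ### From the initial line to the whole domain -/

section Evolution

variable {m : ℕ} {U : Set (Fin (m + 1) → ℝ)}

/-- The components of an analytic map as elements of the algebra of analytic functions. -/
noncomputable def component {f : (Fin (m + 1) → ℝ) → (Fin (m + 1) → ℝ)}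
    (hfa : AnalyticOnNhd ℝ f U) (i : Fin (m + 1)) : analyticFun U :=
  restrictAnalytic (fun x => f x i)
    ((ContinuousLinearMap.proj (R := ℝ) (φ := fun _ : Fin (m + 1) => ℝ) i).comp_analyticOnNhd hfa)

lemma aeval_component_apply {f : (Fin (m + 1) → ℝ) → (Fin (m + 1) → ℝ)}
    (hfa : AnalyticOnNhd ℝ f U) (g : MvPolynomial (Fin (m + 1)) ℝ) (x : U) :
    (MvPolynomial.aeval (component hfa) g).1 x = MvPolynomial.aeval (f x) g :=
  MvPolynomial.comp_aeval_apply (component hfa) (evalAt x) g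

lemma dirDer_component_apply {f : (Fin (m + 1) → ℝ) → (Fin (m + 1) → ℝ)} (hU : IsOpen U)
    (hfa : AnalyticOnNhd ℝ f U) (i j : Fin (m + 1)) (x : U) :
    (dirDer hU (Pi.single j 1) (component hfa i)).1 x = pd j (fun y => f y i) x :=
  congrFun (congrArg Subtype.val (dirDer_mk hU _ _ _)) x

lemma dirDer_eq_sum (hU : IsOpen U) (v : Fin (m + 1) → ℝ) (a : analyticFun U) :
    dirDer hU v a = ∑ j, v j • dirDer hU (Pi.single j 1) a := by
  have hsum : ∀ s : Finset (Fin (m + 1)),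
      dirDer hU (∑ j ∈ s, v j • (Pi.single j (1 : ℝ) : Fin (m + 1) → ℝ)) a =
        ∑ j ∈ s, v j • dirDer hU (Pi.single j 1) a := by
    intro s
    induction s using Finset.induction_on with
    | empty =>
      rw [Finset.sum_empty, Finset.sum_empty, ← zero_smul ℝ v, dirDer_smul, zero_smul,
        Derivation.zero_apply]
    | insert j s hj ih =>
      rw [Finset.sum_insert hj, Finset.sum_insert hj, dirDer_add, dirDer_smul,
        Derivation.add_apply, Derivation.smul_apply, ih]
  rw [← hsum Finset.univ]
  congr 2
  ext i
  simp [Finset.sum_apply, Pi.single_apply]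

/-- Each directional derivative of `χ_f` is, modulo `χ_f`, a polynomial multiple of the derivative
in the last direction. -/
lemma exists_polyDer_eq {f : (Fin (m + 1) → ℝ) → (Fin (m + 1) → ℝ)} (hU : IsOpen U)
    (hfa : AnalyticOnNhd ℝ f U) (hf : SolvesSystem U f) (v : Fin (m + 1) → ℝ) :
    ∃ p q : (analyticFun U)[X], polyDer (dirDer hU v) (companionPoly (component hfa)) =
      p * polyDer (dirDer hU (Pi.single (Fin.last m) 1)) (companionPoly (component hfa)) +
        q * companionPoly (component hfa) := by
  refine exists_polyDer_companionPoly (fun j => dirDer hU (Pi.single j 1)) (component hfa)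
    (fun j i => ?_) (fun j => ?_) (dirDer hU v) v (dirDer_eq_sum hU v)
  · refine Subtype.ext (funext fun x => ?_)
    change (dirDer hU _ _).1 x = f x i.castSucc * (dirDer hU _ _).1 x + (dirDer hU _ _).1 x
    rw [dirDer_component_apply, dirDer_component_apply, dirDer_component_apply]
    exact (hf _ x.2 j).1 i
  · refine Subtype.ext (funext fun x => ?_)
    change (dirDer hU _ _).1 x = f x (Fin.last m) * (dirDer hU _ _).1 x
    rw [dirDer_component_apply, dirDer_component_apply]
    exact (hf _ x.2 j).2

/-- If polynomial relations between the values of `f` on the initial line determine multiplicities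
of roots which force a further relation, then that relation holds everywhere. -/
lemma relation_of_relations_on_line (hU : IsOpen U) (hUc : IsPreconnected U)
    (hUl : ∃ τ : ℝ, initialLine m τ ∈ U)
    {f : (Fin (m + 1) → ℝ) → (Fin (m + 1) → ℝ)} (hfa : AnalyticOnNhd ℝ f U)
    (hf : SolvesSystem U f) (S : Set (MvPolynomial (Fin (m + 1)) ℝ))
    (g : MvPolynomial (Fin (m + 1)) ℝ)
    (hS : ∀ (K : Type) [Field K] [IsAlgClosed K] [Algebra ℝ K] (c : Fin (m + 1) → K),
      (∀ h ∈ S, MvPolynomial.aeval c h = 0) →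
      ∃ M : Multiset K, companionPoly c = (M.map fun a => X - C a).prod ∧
        ∀ (Λ : K → K⟦X⟧) (c' : Fin (m + 1) → K⟦X⟧),
          companionPoly c' = (M.map fun a => X - C (Λ a)).prod → MvPolynomial.aeval c' g = 0)
    (hline : ∀ τ : ℝ, initialLine m τ ∈ U →
      ∀ h ∈ S, MvPolynomial.aeval (f (initialLine m τ)) h = 0) :
    ∀ x ∈ U, MvPolynomial.aeval (f x) g = 0 := by
  intro x hx
  obtain ⟨τ₀, hτ₀⟩ := hUl
  let x₀ : U := ⟨initialLine m τ₀, hτ₀⟩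
  let v₀ : Fin (m + 1) → ℝ := Pi.single (Fin.last m) 1
  let K := AlgebraicClosure (FractionRing ℝ⟦X⟧)
  obtain ⟨D, hD⟩ := exists_derivation_algebraicClosure ℝ ℝ⟦X⟧ (ddX ℝ ℝ)
  have hK : CharZero K := charZero_of_injective_algebraMap (algebraMap ℝ K).injective
  let ι : ℝ⟦X⟧ →ₐ[ℝ] K := IsScalarTower.toAlgHom ℝ ℝ⟦X⟧ K
  have hι : Function.Injective ι := by
    have h1 := IsFractionRing.injective ℝ⟦X⟧ (FractionRing ℝ⟦X⟧)
    have h2 := (algebraMap (FractionRing ℝ⟦X⟧) K).injective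
    exact h2.comp h1
  let T₀ : analyticFun U →ₐ[ℝ] ℝ⟦X⟧ := taylorHom (dirDer hU v₀) (evalAt x₀)
  let ρ : analyticFun U →ₐ[ℝ] K := ι.comp T₀
  have hρ : ∀ r, ρ (dirDer hU v₀ r) = D (ρ r) := fun r => by
    change ι (T₀ (dirDer hU v₀ r)) = D (ι (T₀ r))
    rw [← ddX_taylorHom]
    exact (hD _).symm
  -- Relations along the line survive in `K` because all derivatives in the line direction vanish at
  -- `x₀`.
  have hρS : ∀ h ∈ S, MvPolynomial.aeval (fun i => ρ (component hfa i)) h = 0 := by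
    intro h hh
    have e : MvPolynomial.aeval (fun i => ρ (component hfa i)) h =
        ρ (MvPolynomial.aeval (component hfa) h) := (MvPolynomial.comp_aeval_apply _ _ _).symm
    have hT : T₀ (MvPolynomial.aeval (component hfa) h) = 0 := by
      refine (taylorHom_eq_zero_iff _ _ _).2 fun n => ?_
      have := iterate_dirDer_eq_zero_of_line hU (MvPolynomial.aeval (component hfa) h)
        (initialLine m τ₀) v₀ ?_ n 0 (by simpa using hτ₀)
      · simpa using this
      · intro s hs
        have e2 : initialLine m τ₀ + s • v₀ = initialLine m (τ₀ + s) := by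
          simp only [initialLine, v₀, ← Pi.single_smul, ← Pi.single_add, smul_eq_mul, mul_one]
        rw [aeval_component_apply]
        change MvPolynomial.aeval (f (initialLine m τ₀ + s • v₀)) h = 0
        rw [e2] at hs ⊢
        exact hline _ hs h hh
    rw [e]
    change ι (T₀ _) = 0
    rw [hT, map_zero]
  obtain ⟨M, hM, hMg⟩ := hS K _ hρS
  have key : ∀ (v : Fin (m + 1) → ℝ) (n : ℕ),
      ((dirDer hU v)^[n] (MvPolynomial.aeval (component hfa) g)).1 x₀ = 0 := by
    intro v
    let T : analyticFun U →ₐ[ℝ] K⟦X⟧ := taylorHom (dirDer hU v) ρ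
    have hT0 : T (MvPolynomial.aeval (component hfa) g) = 0 := by
      obtain ⟨p, q, hpq⟩ := exists_polyDer_eq hU hfa hf v
      -- One series is chosen per element of `K`, so repeated initial roots share the same series.
      choose Λ hΛ0 hΛ using exists_burgers D (p.map T.toRingHom)
      have e : T (MvPolynomial.aeval (component hfa) g) =
          MvPolynomial.aeval (fun i => T (component hfa i)) g := MvPolynomial.comp_aeval_apply _ _ _
      rw [e]
      refine hMg Λ _ ?_
      have hmap : (companionPoly (component hfa)).map T.toRingHom =
          companionPoly fun i => T (component hfa i) := map_companionPoly _ _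
      refine eq_prod_of_evolution D (p.map T.toRingHom) Λ hΛ0 hΛ M _ (monic_companionPoly _)
        ⟨q.map T.toRingHom, ?_⟩ ?_
      · have := congrArg (Polynomial.map T.toRingHom) hpq
        rw [Polynomial.map_add, Polynomial.map_mul, Polynomial.map_mul,
          map_polyDer (dirDer hU v) (ddX ℝ K) _ fun a => (ddX_taylorHom _ _ a).symm,
          map_polyDer (dirDer hU v₀) (seriesDer D) _ fun a =>
            (seriesDer_taylorHom _ _ _ D (dirDer_comm hU v v₀) hρ a).symm, hmap] at this
        exact this
      · rw [map_companionPoly, ← hM]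
        congr 1
        funext i
        exact constantCoeff_taylorHom _ _ _
    intro n
    have h1 := (taylorHom_eq_zero_iff _ _ _).1 hT0 n
    -- Vanishing in `K` descends to `ℝ⟦X⟧` by injectivity of `ι`; its constant coefficient is the
    -- value at `x₀`.
    have h2 : T₀ ((dirDer hU v)^[n] (MvPolynomial.aeval (component hfa) g)) = 0 :=
      hι (h1.trans (map_zero ι).symm)
    exact (taylorHom_eq_zero_iff _ _ _).1 h2 0
  have := analyticFun_eq_zero hU hUc (MvPolynomial.aeval (component hfa) g) x₀ key ⟨x, hx⟩
  rwa [aeval_component_apply] at this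

end Evolution

end NijenhuisCompanion

theorem mainTheorem8 (m : ℕ) (U : Set (Fin (m + 1) → ℝ)) (hUo : IsOpen U) (hUc : IsConnected U)
    (hUl : ∃ τ : ℝ, NijenhuisCompanion.initialLine m τ ∈ U)
    (f : (Fin (m + 1) → ℝ) → (Fin (m + 1) → ℝ)) (hfa : AnalyticOnNhd ℝ f U)
    (hf : NijenhuisCompanion.SolvesSystem U f) :
    ((∀ τ : ℝ, NijenhuisCompanion.initialLine m τ ∈ U →
        (NijenhuisCompanion.charPoly (f (NijenhuisCompanion.initialLine m τ))).discr = 0) →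
      ∀ x ∈ U, (NijenhuisCompanion.charPoly (f x)).discr = 0) ∧
    (∀ (s : ℕ) (k : Fin s → ℕ), (∀ i, 0 < k i) → ∑ i, k i = m + 1 →
      (∀ τ : ℝ, NijenhuisCompanion.initialLine m τ ∈ U →
        f (NijenhuisCompanion.initialLine m τ) ∈
          NijenhuisCompanion.zariskiClosure (NijenhuisCompanion.layer k)) →
      ∀ x ∈ U, f x ∈ NijenhuisCompanion.zariskiClosure (NijenhuisCompanion.layer k)) := by
  constructor
  · intro hline x hx
    rw [NijenhuisCompanion.discr_charPoly_eq_zero_iff]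
    refine NijenhuisCompanion.relation_of_relations_on_line hUo hUc.isPreconnected hUl hfa hf
      {NijenhuisCompanion.resultantPoly m} _ ?_ ?_ x hx
    · intro K _ _ _ c hc
      have hnd := NijenhuisCompanion.not_nodup_roots_of_aeval_resultantPoly c (hc _ rfl)
      refine ⟨_, (IsAlgClosed.splits _).eq_prod_roots_of_monic
        (NijenhuisCompanion.monic_companionPoly c), fun Λ c' hc' => ?_⟩
      -- A root `a` occurring twice initially yields the square factor `(X - Λ a)²` over the power
      -- series.
      rw [Multiset.nodup_iff_ne_cons_cons] at hnd
      push Not at hnd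
      obtain ⟨a, t, ht⟩ := hnd
      refine NijenhuisCompanion.aeval_resultantPoly_eq_zero c' (b := Λ a)
        (q := (t.map fun a => X - C (Λ a)).prod) ?_
      rw [hc', ht]
      simp only [Multiset.map_cons, Multiset.prod_cons]
      ring
    · rintro τ hτ h rfl
      exact (NijenhuisCompanion.discr_charPoly_eq_zero_iff _).1 (hline τ hτ)
  · intro s k hpos hk hline x hx g hg
    refine NijenhuisCompanion.relation_of_relations_on_line hUo hUc.isPreconnected hUl hfa hf
      (MvPolynomial.vanishingIdeal ℝ (NijenhuisCompanion.layer k) :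
        Ideal (MvPolynomial (Fin (m + 1)) ℝ)) g ?_ (fun τ hτ h hh => hline τ hτ h hh) x hx
    intro K _ _ _ c hc
    obtain ⟨μ, hμ⟩ := NijenhuisCompanion.exists_roots_of_zero_vanishingIdeal hpos hk c hc
    -- The `μ i` may coincide; only the factorization with exponents `k i` is used, since `g` pulls
    -- back to zero identically in the roots.
    refine ⟨∑ i, k i • {μ i}, ?_, fun Λ c' hc' => ?_⟩
    · rw [hμ, NijenhuisCompanion.prod_map_sum_nsmul]
      rfl
    · have h : NijenhuisCompanion.companionPoly c' =
          NijenhuisCompanion.rootsPoly k fun i => Λ (μ i) := by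
        rw [hc', NijenhuisCompanion.prod_map_sum_nsmul]
        rfl
      rw [NijenhuisCompanion.aeval_eq_aeval_bind₁_layerCoord hk h,
        NijenhuisCompanion.bind₁_layerCoord_eq_zero hpos hk hg, map_zero]
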